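/- **Darboux's theorem on overdetermined systems.** Let $n\ge 0$, let $\mathcal I$ be a set of nonempty strictly increasing multi-indices over $\{1,\dots,n\}$ (regarded as subsets of $\{1,\dots,n\}$), and for each $I\in\mathcal I$ let $u^I$ be an unknown function of $x=(x_1,\dots,x_n)$ with values in some $\mathbb R^{m_I}$; write $U=(u^I)_{I\in\mathcal I}$. For $i\in I\in\mathcal I$ put $\mathcal I^I_i=\{J\in\mathcal I : J\supset I\smallsetminus i\}$ and $U^I_i=(u^J)_{J\in\mathcal I^I_i}$. Consider the system $$u^I_{x_i}(x)=F^I_i\big(x;U^I_i(x)\big)\qquad\text{whenever } i\in I\in\mathcal I, \tag{1}$$ where the $F^I_i$ are $C^2$ functions defined for $(x,U)$ in an open neighborhood $\Omega$ of a given point $(\bar x,\bar U)$ (each $F^I_i$ depending only on $x$ and $U^I_i$). Assume that (1) is a Darboux system near $(\bar x,\bar U)$, i.e. that for all $I\in\mathcal I$ and all distinct $i,j\in I$ the integrability condition $$F^I_{i,x_j}(x;U^I_i)+\sum_{J\in\mathcal I^I_i}F^I_{i,u^J}(x;U^I_i)\,F^J_j(x;U^J_j) =F^I_{j,x_i}(x;U^I_j)+\sum_{J\in\mathcal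 I^I_j}F^I_{j,u^J}(x;U^I_j)\,F^J_i(x;U^J_i)$$ holds identically for $(x,U)\in\Omega$. (Here $j\in J$ for $J\in\mathcal I^I_i$, so that $F^J_j$ is one of the given functions; likewise for $F^J_i$.) For each $I\in\mathcal I$ let $\bar u^I$ be an $\mathbb R^{m_I}$-valued function of the variables $x_{I^c}=(x_k)_{k\notin I}$ that is $C^2$ near $\bar x_{I^c}$, with $\bar u^I(\bar x_{I^c})=\bar U^I$, and prescribe the data $$u^I(x)=\bar u^I(x_{I^c})\qquad\text{whenever } x_i=\bar x_i \text{ for all } i\in I. \tag{2}$$ Then there are arbitrarily small open neighborhoods $V$ of $\bar x$ on which (1) has a unique $C^2$ solution $U$ (with $(x,U(x))\in\Omega$ for $x\in V$) taking on the data (2). -/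

import Mathlib

open Topology

/-- A closed first order system in `n` independent variables, in the form
`u^I_{x_i}(x) = F^I_i(x; U^I_i(x))` for `i ∈ I ∈ 𝓘`.

Strictly increasing multi-indices over `{1, …, n}` are represented by finite subsets of `Fin n`.
`idx` is the set `𝓘` of multi-indices, `dim I` is the number of scalar components of the unknown
`u^I`, and `F I i hi` is the right-hand side `F^I_i`, a function of `x` and of those unknowns `u^J`,
`J ∈ 𝓘`, with `J ⊇ I ∖ i`. -/
structure MultiIndexSystem (n : ℕ) where
  idx : Finset (Finset (Fin n))
  /-- The system is closed: some partial derivative of each unknown is prescribed. -/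
  idx_nonempty : ∀ I ∈ idx, I.Nonempty
  dim : idx → ℕ
  F : (I : idx) → (i : Fin n) → i ∈ I.1 →
    (Fin n → ℝ) × ((J : {J : idx // I.1.erase i ⊆ J.1}) → Fin (dim J.1) → ℝ) →
      (Fin (dim I) → ℝ)

namespace MultiIndexSystem

variable {n : ℕ} (S : MultiIndexSystem n)

/-- The space of values `U = (u^I)_{I ∈ 𝓘}` of all unknowns. -/
abbrev Unknowns : Type := (I : S.idx) → Fin (S.dim I) → ℝ

/-- The index set `𝓘^I_i = {J ∈ 𝓘 | J ⊇ I ∖ i}`. -/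
abbrev Deps (I : S.idx) (i : Fin n) : Type := {J : S.idx // I.1.erase i ⊆ J.1}

/-- The map `(x, U) ↦ (x, U^I_i)`, where `U^I_i = (u^J)_{J ∈ 𝓘^I_i}`. -/
def restr (I : S.idx) (i : Fin n) (p : (Fin n → ℝ) × S.Unknowns) :
    (Fin n → ℝ) × ((J : S.Deps I i) → Fin (S.dim J.1) → ℝ) :=
  (p.1, fun J => p.2 J.1)

/-- The value `F^I_i(x; U^I_i)` at `p = (x, U)`. -/
def rhs (I : S.idx) (i : Fin n) (hi : i ∈ I.1) (p : (Fin n → ℝ) × S.Unknowns) :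
    Fin (S.dim I) → ℝ :=
  S.F I i hi (S.restr I i p)

theorem mem_of_deps {I : S.idx} {i j : Fin n} (hj : j ∈ I.1) (hij : i ≠ j)
    (J : S.Deps I i) : j ∈ J.1.1 :=
  J.2 (Finset.mem_erase.2 ⟨hij.symm, hj⟩)

/-- The partial derivative `F^I_{i,x_j}(x; U^I_i)`. -/
noncomputable def dx (I : S.idx) (i : Fin n) (hi : i ∈ I.1) (j : Fin n)
    (p : (Fin n → ℝ) × S.Unknowns) : Fin (S.dim I) → ℝ :=
  fderiv ℝ (S.F I i hi) (S.restr I i p) (Pi.single j 1, 0)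

/-- The Jacobian `F^I_{i,u^J}(x; U^I_i)` with respect to `u^J`, applied to a vector `w`. -/
noncomputable def du (I : S.idx) (i : Fin n) (hi : i ∈ I.1) (J : S.Deps I i)
    (w : Fin (S.dim J.1) → ℝ) (p : (Fin n → ℝ) × S.Unknowns) : Fin (S.dim I) → ℝ :=
  fderiv ℝ (S.F I i hi) (S.restr I i p) (0, Pi.single J w)

/-- The expression
`F^I_{i,x_j}(x; U^I_i) + ∑_{J ∈ 𝓘^I_i} F^I_{i,u^J}(x; U^I_i) F^J_j(x; U^J_j)`,
for distinct `i, j ∈ I`. -/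
noncomputable def crossDeriv (I : S.idx) (i j : Fin n) (hi : i ∈ I.1) (hj : j ∈ I.1) (hij : i ≠ j)
    (p : (Fin n → ℝ) × S.Unknowns) : Fin (S.dim I) → ℝ :=
  S.dx I i hi j p +
    ∑ J : S.Deps I i, S.du I i hi J (S.rhs J.1 j (S.mem_of_deps hj hij J) p) p

/-- The integrability conditions hold identically in `(x, U) ∈ Ω`. -/
def IsDarbouxOn (Ω : Set ((Fin n → ℝ) × S.Unknowns)) : Prop :=
  ∀ p ∈ Ω, ∀ (I : S.idx) (i j : Fin n) (hi : i ∈ I.1) (hj : j ∈ I.1) (hij : i ≠ j),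
    S.crossDeriv I i j hi hj hij p = S.crossDeriv I j i hj hi hij.symm p

/-- All right-hand sides `F^I_i` are `C²` at the points `(x, U^I_i)` with `(x, U) ∈ Ω`. -/
def IsC2On (Ω : Set ((Fin n → ℝ) × S.Unknowns)) : Prop :=
  ∀ p ∈ Ω, ∀ (I : S.idx) (i : Fin n) (hi : i ∈ I.1),
    ContDiffAt ℝ 2 (S.F I i hi) (S.restr I i p)

/-- The data: for each `I ∈ 𝓘` a function `ū^I` of the variables `x_{I^c}`. -/
abbrev Data : Type := (I : S.idx) → ({j : Fin n // j ∉ I.1} → ℝ) → (Fin (S.dim I) → ℝ)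

/-- The point `x_{I^c}`. -/
def compl (I : S.idx) (x : Fin n → ℝ) : {j : Fin n // j ∉ I.1} → ℝ := fun j => x j.1

/-- `U` is a `C²` solution on `V`, with `(x, U(x))` in the domain `Ω` of the right-hand sides,
which takes the data `u^I(x) = ū^I(x_{I^c})` wherever `x ∈ V` and `x_I = x̄_I`. -/
structure IsSolution (Ω : Set ((Fin n → ℝ) × S.Unknowns)) (xbar : Fin n → ℝ) (ubar : S.Data)
    (V : Set (Fin n → ℝ)) (U : (Fin n → ℝ) → S.Unknowns) : Prop where
  contDiffOn : ContDiffOn ℝ 2 U V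
  mem_domain : ∀ x ∈ V, (x, U x) ∈ Ω
  eqn : ∀ x ∈ V, ∀ (I : S.idx) (i : Fin n) (hi : i ∈ I.1),
    fderiv ℝ (fun y => U y I) x (Pi.single i 1) = S.rhs I i hi (x, U x)
  data : ∀ x ∈ V, ∀ I : S.idx, (∀ i ∈ I.1, x i = xbar i) → U x I = ubar I (S.compl I x)

end MultiIndexSystem

/-! Existence. Of the equations for `u^I`, keep at first only the combination along the vector `(x -
x̄)_I`. With the data it is equivalent to an integral equation: `u^I(x)` is `ū^I` plus the integral
of `∑ (x_i - x̄_i) F^I_i` over the segment that scales the coordinates in `I` from `x̄_I` to `x_I`.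
Different unknowns use different segments, but all of them stay in the box `x̄ + t z`, `t ∈
[0,1]^n`, `z = x - x̄`. Writing the unknown as a function of `t` on this fixed cube, with `z` as a
parameter, turns the equation into the vanishing of a `C²` map between Banach spaces
(`radialDefect`) whose derivative in the unknown is the identity at `z = 0`. The implicit function
theorem solves it, with `C²` dependence on `z`; its local uniqueness makes the solutions for
different `z` fit together (`exists_radialDefect_eq_zero`), so evaluation at `t = 1` gives a `C²`
function `U` (`exists_radial_solution`).

It remains to see that the defects `D_i = u^I_{x_i} - F^I_i` vanish. The radial equation says `∑ z_i
D_i = 0` over `i ∈ I`. Differentiating it in `x_i` and exchanging `∂_i D_j` for `∂_j D_i`, which by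
integrability costs only terms linear in the defects, gives `D_i + (z_I · ∇) D_i = O(|z| |D|)`
(`defect_add_fderiv_defect`). The left side is the derivative of `s D_i` along the segment, so on a
small ball `sup |D| ≤ sup |D| / 2`, whence `D = 0` (`defect_eq_zero`).

Uniqueness. Any solution obeys the radial equations, and a Grönwall argument with an exponentially
weighted maximum applies on every ball, small or not (`IsSolution.eqOn_ball`). -/

namespace ContinuousMap

/-! ### Superposition operators on spaces of continuous functions -/

variable {K E F : Type*} [TopologicalSpace K] [CompactSpace K]
  [NormedAddCommGroup E] [NormedSpace ℝ E] [NormedAddCommGroup F] [NormedSpace ℝ F]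

/-- Pointwise application of operator-valued functions, as a bounded bilinear map. -/
noncomputable def pointwiseApply :
    C(K, E →L[ℝ] F) →L[ℝ] C(K, E) →L[ℝ] C(K, F) :=
  LinearMap.mkContinuous₂
    (LinearMap.mk₂ ℝ
      (fun (A : C(K, E →L[ℝ] F)) (h : C(K, E)) =>
        (⟨fun t => A t (h t), by fun_prop⟩ : C(K, F)))
      (fun A A' h => by ext t; simp) (fun c A h => by ext t; simp)
      (fun A h h' => by ext t; simp) (fun c A h => by ext t; simp)) 1
    (fun A h => by
      refine (ContinuousMap.norm_le _ (by positivity)).2 fun t => ?_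
      rw [one_mul]
      exact ((A t).le_opNorm _).trans
        (mul_le_mul (A.norm_coe_le_norm t) (h.norm_coe_le_norm t) (norm_nonneg _) (norm_nonneg A)))

@[simp]
theorem pointwiseApply_apply (A : C(K, E →L[ℝ] F)) (h : C(K, E)) (t : K) :
    pointwiseApply A h t = A t (h t) := rfl

theorem _root_.ContDiff.pointwiseApply {X : Type*} [NormedAddCommGroup X] [NormedSpace ℝ X]
    {k : WithTop ℕ∞} {A : X → C(K, E →L[ℝ] F)} {h : X → C(K, E)} (hA : ContDiff ℝ k A)
    (hh : ContDiff ℝ k h) : ContDiff ℝ k fun x => ContinuousMap.pointwiseApply (A x) (h x) :=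
  have hL : ContDiff ℝ k
      (fun A : C(K, E →L[ℝ] F) => ContinuousMap.pointwiseApply (K := K) (E := E) (F := F) A) :=
    ContinuousLinearMap.contDiff _
  (hL.comp hA).clm_apply hh

/-- Postcomposition with `f'` is continuous for the sup norm, so `f'` varies by less than `ε` along
all the segments from `φ t` to `φ t + h t`, uniformly in `t`, once `h` is small. The mean value
inequality then makes the remainder uniform in `t`. -/
theorem hasFDerivAt_postcomp {f : E → F} {f' : E → E →L[ℝ] F}
    (hf : ∀ x, HasFDerivAt f (f' x) x) (hc : Continuous f) (hc' : Continuous f') (φ : C(K, E)) :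
    HasFDerivAt (fun φ : C(K, E) => (⟨f, hc⟩ : C(E, F)).comp φ)
      (pointwiseApply ((⟨f', hc'⟩ : C(E, E →L[ℝ] F)).comp φ)) φ := by
  rw [hasFDerivAt_iff_isLittleO_nhds_zero, Asymptotics.isLittleO_iff]
  intro ε hε
  have hcont : Continuous fun φ : C(K, E) => (⟨f', hc'⟩ : C(E, E →L[ℝ] F)).comp φ :=
    ContinuousMap.continuous_postcomp _
  obtain ⟨δ, hδ, hδ'⟩ := (Metric.continuousAt_iff (α := C(K, E))
    (β := C(K, E →L[ℝ] F))).1 (hcont.continuousAt (x := φ)) ε hε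
  filter_upwards [Metric.ball_mem_nhds (0 : C(K, E)) hδ] with h hh
  rw [mem_ball_zero_iff] at hh
  refine (ContinuousMap.norm_le _ (by positivity)).2 fun t => ?_
  have key := (convex_segment (𝕜 := ℝ) (φ t) (φ t + h t)).norm_image_sub_le_of_norm_hasFDerivWithin_le'
    (f := f) (f' := f') (φ := f' (φ t)) (C := ε) (fun x _ => (hf x).hasFDerivWithinAt) ?_
    (left_mem_segment ℝ _ _) (right_mem_segment ℝ _ _)
  · refine le_trans (le_of_eq ?_)
      (key.trans (mul_le_mul_of_nonneg_left
        (by simpa using h.norm_coe_le_norm t) hε.le))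
    simp
  · rintro x hx
    rw [segment_eq_image'] at hx
    obtain ⟨θ, hθ, rfl⟩ := hx
    have h1 : dist (φ + θ • h) φ < δ := by
      rw [dist_eq_norm, add_sub_cancel_left, norm_smul, Real.norm_of_nonneg hθ.1]
      exact lt_of_le_of_lt (mul_le_of_le_one_left (norm_nonneg _) hθ.2) hh
    have h2 := (ContinuousMap.dist_apply_le_dist t).trans_lt (hδ' h1)
    rw [dist_eq_norm] at h2
    simpa using h2.le

theorem contDiff_one_postcomp {f : E → F} (hf : ContDiff ℝ 1 f) :
    ContDiff ℝ 1 (fun φ : C(K, E) => (⟨f, hf.continuous⟩ : C(E, F)).comp φ) := by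
  have hd := fun x => (hf.differentiable one_ne_zero x).hasFDerivAt
  have hc' := hf.continuous_fderiv one_ne_zero
  refine contDiff_one_iff_hasFDerivAt.2
    ⟨_, ?_, hasFDerivAt_postcomp hd hf.continuous hc'⟩
  exact pointwiseApply.continuous.comp (ContinuousMap.continuous_postcomp _)

/-- The derivative is postcomposition with `fderiv ℝ f` followed by the bounded linear map
`pointwiseApply`, which reduces `C²` for `f` to `C¹` for `fderiv ℝ f`. -/
theorem contDiff_two_postcomp {f : E → F} (hf : ContDiff ℝ 2 f) :
    ContDiff ℝ 2 (fun φ : C(K, E) => (⟨f, hf.continuous⟩ : C(E, F)).comp φ) := by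
  have hd := fun x => (hf.differentiable two_ne_zero x).hasFDerivAt
  have h1 : ContDiff ℝ 1 (fderiv ℝ f) := hf.fderiv_right (by norm_num)
  have hc := hf.continuous
  suffices h : ContDiff ℝ (1 + 1) fun φ : C(K, E) => (⟨f, hc⟩ : C(E, F)).comp φ by
    rwa [one_add_one_eq_two] at h
  rw [contDiff_succ_iff_fderiv]
  have hF := hasFDerivAt_postcomp (K := K) hd hf.continuous h1.continuous
  refine ⟨fun φ => (hF φ).differentiableAt, by simp, ?_⟩
  rw [show fderiv ℝ (fun φ : C(K, E) => (⟨f, hf.continuous⟩ : C(E, F)).comp φ) = _ from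
    funext fun φ => (hF φ).fderiv]
  exact (pointwiseApply (K := K) (E := E) (F := F)).contDiff.comp (contDiff_one_postcomp h1)

/-- Averaging of a function along a continuous family of self-maps, as a bounded operator. -/
noncomputable def average [CompleteSpace E] (σ : C(ℝ × K, K)) : C(K, E) →L[ℝ] C(K, E) :=
  LinearMap.mkContinuous
    { toFun := fun γ => ⟨fun t => ∫ s in (0 : ℝ)..1, γ (σ (s, t)),
        intervalIntegral.continuous_parametric_intervalIntegral_of_continuous'
          (f := fun t s => γ (σ (s, t))) (by fun_prop) 0 1⟩
      map_add' := fun γ γ' => by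
        ext t
        exact intervalIntegral.integral_add
          (Continuous.intervalIntegrable (by fun_prop) _ _)
          (Continuous.intervalIntegrable (by fun_prop) _ _)
      map_smul' := fun c γ => by
        ext t
        exact intervalIntegral.integral_smul c _ } 1
    (fun γ => by
      refine (ContinuousMap.norm_le _ (by positivity)).2 fun t => ?_
      have := intervalIntegral.norm_integral_le_of_norm_le_const (a := 0) (b := 1)
        (f := fun s => γ (σ (s, t))) (C := ‖γ‖) fun s _ => γ.norm_coe_le_norm _
      simpa using this)

theorem average_apply [CompleteSpace E] (σ : C(ℝ × K, K)) (γ : C(K, E)) (t : K) :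
    average σ γ t = ∫ s in (0 : ℝ)..1, γ (σ (s, t)) := rfl

end ContinuousMap

/-- A function that is `C²` at a point agrees near it with a globally `C²` function. -/
theorem ContDiffAt.exists_contDiff_two_eventuallyEq {E F : Type*} [NormedAddCommGroup E]
    [NormedSpace ℝ E] [FiniteDimensional ℝ E] [NormedAddCommGroup F] [NormedSpace ℝ F]
    {f : E → F} {x : E} (hf : ContDiffAt ℝ 2 f x) :
    ∃ g : E → F, ContDiff ℝ 2 g ∧ g =ᶠ[𝓝 x] f := by
  obtain ⟨r, hr, hball⟩ := Metric.eventually_nhds_iff_ball.1 (hf.eventually (by simp))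
  let b : ContDiffBump x := ⟨r / 4, r / 2, by positivity, by linarith⟩
  refine ⟨fun y => b y • f y, contDiff_iff_contDiffAt.2 fun y => ?_, ?_⟩
  · by_cases hy : y ∈ Metric.ball x r
    · exact b.contDiffAt.smul (hball y hy)
    · have hy' : y ∉ tsupport b := fun h =>
        hy (Metric.closedBall_subset_ball (by simp only [b]; linarith) (b.tsupport_eq ▸ h))
      refine (contDiffAt_const (c := (0 : F))).congr_of_eventuallyEq ?_
      filter_upwards [notMem_tsupport_iff_eventuallyEq.1 hy'] with z hz
      simp [hz]
  · filter_upwards [b.eventuallyEq_one] with y hy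
    simp [hy]

/-! ### The radial integral equation on the cube -/

section RadialIntegralEquation

open ContinuousMap

variable {n : ℕ}

/-- The restriction of a vector to the coordinates in `A`. -/
noncomputable def coordProj (A : Finset (Fin n)) : (Fin n → ℝ) →L[ℝ] (Fin n → ℝ) :=
  ContinuousLinearMap.pi fun i => if i ∈ A then ContinuousLinearMap.proj i else 0

theorem coordProj_apply (A : Finset (Fin n)) (z : Fin n → ℝ) (i : Fin n) :
    coordProj A z i = if i ∈ A then z i else 0 := by
  by_cases h : i ∈ A <;> simp [coordProj, h]

theorem coordProj_coordProj (A : Finset (Fin n)) (z : Fin n → ℝ) :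
    coordProj A (coordProj A z) = coordProj A z := by
  ext i
  simp only [coordProj_apply]
  split_ifs <;> rfl

/-- The maps of the cube that multiply the coordinates in `A` by `s ∈ [0, 1]`. -/
noncomputable def shrink (A : Finset (Fin n)) : C(ℝ × (Fin n → unitInterval), Fin n → unitInterval) where
  toFun p i := if i ∈ A then Set.projIcc 0 1 zero_le_one p.1 * p.2 i else p.2 i
  continuous_toFun := by
    refine continuous_pi fun i => ?_
    by_cases h : i ∈ A
    · simp only [h, if_true]
      exact (continuous_projIcc.comp continuous_fst).mul (by fun_prop)
    · simp only [h, if_false]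
      fun_prop

/-- The family of points `(t_i z_i)`, where `t` ranges over the unit cube. -/
noncomputable def cubeScale : (Fin n → ℝ) →L[ℝ] C(Fin n → unitInterval, Fin n → ℝ) :=
  LinearMap.toContinuousLinearMap
    { toFun := fun z => ⟨fun t i => (t i : ℝ) * z i, by fun_prop⟩
      map_add' := fun z w => by ext t i; simp [mul_add]
      map_smul' := fun c z => by ext t i; simp; ring }

theorem cubeScale_apply (z : Fin n → ℝ) (t : Fin n → unitInterval) (i : Fin n) :
    cubeScale z t i = t i * z i := rfl

theorem norm_cubeScale_apply_le (z : Fin n → ℝ) (t : Fin n → unitInterval) : ‖cubeScale z t‖ ≤ ‖z‖ := by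
  refine (pi_norm_le_iff_of_nonneg (norm_nonneg _)).2 fun i => ?_
  rw [cubeScale_apply, norm_mul, Real.norm_of_nonneg (t i).2.1]
  exact (mul_le_of_le_one_left (norm_nonneg _) (t i).2.2).trans (norm_le_pi_norm z i)

variable {ι : Type*} [Fintype ι] {E : ι → Type*} [∀ a, NormedAddCommGroup (E a)]
  [∀ a, NormedSpace ℝ (E a)]

/-- The pair of two vector-valued functions on the cube, as a bounded operator. -/
noncomputable def cubePair {X Y : Type*} [NormedAddCommGroup X] [NormedSpace ℝ X]
    [NormedAddCommGroup Y] [NormedSpace ℝ Y] :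
    C(Fin n → unitInterval, X) × C(Fin n → unitInterval, Y) →L[ℝ] C(Fin n → unitInterval, X × Y) :=
  (ContinuousLinearMap.compLeftContinuous ℝ (Fin n → unitInterval) (ContinuousLinearMap.inl ℝ X Y)).comp
      (ContinuousLinearMap.fst ℝ _ _) +
    (ContinuousLinearMap.compLeftContinuous ℝ (Fin n → unitInterval) (ContinuousLinearMap.inr ℝ X Y)).comp
      (ContinuousLinearMap.snd ℝ _ _)

theorem cubePair_apply {X Y : Type*} [NormedAddCommGroup X] [NormedSpace ℝ X]
    [NormedAddCommGroup Y] [NormedSpace ℝ Y] (f : C(Fin n → unitInterval, X)) (g : C(Fin n → unitInterval, Y))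
    (t : Fin n → unitInterval) : cubePair (f, g) t = (f t, g t) := by
  simp [cubePair]

open Classical in
/-- The operator `T ↦ (w ↦ T(w_{I_a})_a)` on linear maps with values in a product. -/
noncomputable def componentOp (S : ι → Finset (Fin n)) (a : ι) :
    ((Fin n → ℝ) →L[ℝ] (∀ a, E a)) →L[ℝ] ((Fin n → ℝ) →L[ℝ] (∀ a, E a)) :=
  ((ContinuousLinearMap.compL ℝ (Fin n → ℝ) (Fin n → ℝ) (∀ a, E a)).flip (coordProj (S a))).comp
    (ContinuousLinearMap.compL ℝ (Fin n → ℝ) (∀ a, E a) (∀ a, E a)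
      ((ContinuousLinearMap.single ℝ E a).comp (ContinuousLinearMap.proj a)))

/-- The averages of the components of an operator-valued function along radial segments. -/
noncomputable def radialAverage [∀ a, CompleteSpace (E a)] (S : ι → Finset (Fin n)) :
    C(Fin n → unitInterval, (Fin n → ℝ) →L[ℝ] (∀ a, E a)) →L[ℝ] C(Fin n → unitInterval, (Fin n → ℝ) →L[ℝ] (∀ a, E a)) :=
  ∑ a, (ContinuousLinearMap.compLeftContinuous ℝ (Fin n → unitInterval) (componentOp S a)).comp
    (average (shrink (S a)))

theorem radialAverage_apply [∀ a, CompleteSpace (E a)] (S : ι → Finset (Fin n))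
    (γ : C(Fin n → unitInterval, (Fin n → ℝ) →L[ℝ] (∀ a, E a))) (t : Fin n → unitInterval) (w : Fin n → ℝ) (a : ι) :
    radialAverage S γ t w a =
      ∫ s in (0 : ℝ)..1, γ (shrink (S a) (s, t)) (coordProj (S a) w) a := by
  classical
  have h1 : radialAverage S γ t w a =
      (∫ s in (0 : ℝ)..1, γ (shrink (S a) (s, t))) (coordProj (S a) w) a := by
    simp only [radialAverage, _root_.sum_apply, ContinuousMap.sum_apply,
      Finset.sum_apply]
    rw [Finset.sum_eq_single a]
    · simp [componentOp, average_apply]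
    · intro b _ hb
      simp [componentOp, hb.symm]
    · simp
  let L : ((Fin n → ℝ) →L[ℝ] (∀ a, E a)) →L[ℝ] E a :=
    (ContinuousLinearMap.proj a).comp (ContinuousLinearMap.apply ℝ _ (coordProj (S a) w))
  rw [h1]
  exact (L.intervalIntegral_comp_comm
    (Continuous.intervalIntegrable (by fun_prop) _ _)).symm

/-- The defect in the radial integral equation. -/
noncomputable def radialDefect [∀ a, CompleteSpace (E a)] (S : ι → Finset (Fin n))
    (xbar : Fin n → ℝ) (v : C(Fin n → ℝ, ∀ a, E a))
    (G : C((Fin n → ℝ) × (∀ a, E a), (Fin n → ℝ) →L[ℝ] (∀ a, E a)))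
    (p : (Fin n → ℝ) × C(Fin n → unitInterval, ∀ a, E a)) : C(Fin n → unitInterval, ∀ a, E a) :=
  p.2 - v.comp (const _ xbar + cubeScale p.1) -
    pointwiseApply
      (radialAverage S (G.comp (cubePair (const _ xbar + cubeScale p.1, p.2)))) (cubeScale p.1)

theorem contDiff_radialDefect [∀ a, CompleteSpace (E a)] (S : ι → Finset (Fin n))
    (xbar : Fin n → ℝ) (v : C(Fin n → ℝ, ∀ a, E a)) (hv : ContDiff ℝ 2 v)
    (G : C((Fin n → ℝ) × (∀ a, E a), (Fin n → ℝ) →L[ℝ] (∀ a, E a))) (hG : ContDiff ℝ 2 G) :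
    ContDiff ℝ 2 (radialDefect S xbar v G) := by
  have hx : ContDiff ℝ 2 fun p : (Fin n → ℝ) × C(Fin n → unitInterval, ∀ a, E a) =>
      (const (Fin n → unitInterval) xbar + cubeScale p.1 : C(Fin n → unitInterval, Fin n → ℝ)) :=
    contDiff_const.add (cubeScale.contDiff.comp contDiff_fst)
  have hv' := (contDiff_two_postcomp (K := Fin n → unitInterval) hv).comp hx
  have hp : ContDiff ℝ 2 fun p : (Fin n → ℝ) × C(Fin n → unitInterval, ∀ a, E a) =>
      cubePair (n := n) (const (Fin n → unitInterval) xbar + cubeScale p.1, p.2) :=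
    (cubePair (n := n) (X := Fin n → ℝ) (Y := ∀ a, E a)).contDiff.comp (hx.prodMk contDiff_snd)
  have hG' := (contDiff_two_postcomp (K := Fin n → unitInterval) hG).comp hp
  have hA := (ContinuousLinearMap.contDiff (n := 2)
    (E := C(Fin n → unitInterval, (Fin n → ℝ) →L[ℝ] (∀ a, E a)))
    (F := C(Fin n → unitInterval, (Fin n → ℝ) →L[ℝ] (∀ a, E a))) (radialAverage S)).comp hG'
  exact (contDiff_snd.sub hv').sub (ContDiff.pointwiseApply hA (cubeScale.contDiff.comp contDiff_fst))

/-- Shrinking some coordinates commutes with multiplication by `τ` on the cube, so restricting to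
the sub-box of `τ z` respects the equation. This is what lets solutions for different `z` be
compared. -/
theorem radialDefect_comp [∀ a, CompleteSpace (E a)] (S : ι → Finset (Fin n))
    (xbar : Fin n → ℝ) (v : C(Fin n → ℝ, ∀ a, E a))
    (G : C((Fin n → ℝ) × (∀ a, E a), (Fin n → ℝ) →L[ℝ] (∀ a, E a)))
    (z : Fin n → ℝ) (φ : C(Fin n → unitInterval, ∀ a, E a)) (τ : Fin n → unitInterval) :
    radialDefect S xbar v G (cubeScale z τ, φ.comp ⟨fun t => τ * t, by fun_prop⟩) =
      (radialDefect S xbar v G (z, φ)).comp ⟨fun t => τ * t, by fun_prop⟩ := by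
  have h1 : ∀ t, cubeScale (cubeScale z τ) t = cubeScale z (τ * t) := fun t => by
    ext i
    simp only [cubeScale_apply, Pi.mul_apply, Set.Icc.coe_mul]
    ring
  have h2 : ∀ (a : ι) (s : ℝ) (t : Fin n → unitInterval),
      shrink (S a) (s, τ * t) = τ * shrink (S a) (s, t) := fun a s t => by
    ext i
    simp only [shrink, ContinuousMap.coe_mk, Pi.mul_apply]
    split_ifs
    · simp only [Set.Icc.coe_mul]; ring
    · rfl
  ext t a
  simp only [radialDefect, ContinuousMap.sub_apply, Pi.sub_apply, ContinuousMap.comp_apply,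
    pointwiseApply_apply, radialAverage_apply, cubePair_apply, ContinuousMap.add_apply, h1, h2,
    ContinuousMap.coe_mk, ContinuousMap.const_apply]

/-- At `z = 0` the integral term vanishes, since it is applied to `cubeScale 0 = 0`, and `φ` enters
only through `φ - const`. -/
theorem isInvertible_fderiv_radialDefect [∀ a, CompleteSpace (E a)] (S : ι → Finset (Fin n))
    (xbar : Fin n → ℝ) (v : C(Fin n → ℝ, ∀ a, E a)) (hv : ContDiff ℝ 2 v)
    (G : C((Fin n → ℝ) × (∀ a, E a), (Fin n → ℝ) →L[ℝ] (∀ a, E a))) (hG : ContDiff ℝ 2 G)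
    (φ : C(Fin n → unitInterval, ∀ a, E a)) :
    (fderiv ℝ (radialDefect S xbar v G) (0, φ) ∘L
      ContinuousLinearMap.inr ℝ (Fin n → ℝ) C(Fin n → unitInterval, ∀ a, E a)).IsInvertible := by
  have hd := ((contDiff_radialDefect S xbar v hv G hG).differentiable two_ne_zero
    (0, φ)).hasFDerivAt.comp φ (hasFDerivAt_prodMk_right (0 : Fin n → ℝ) φ)
  have hd' : HasFDerivAt (radialDefect S xbar v G ∘ fun ψ => ((0 : Fin n → ℝ), ψ))
      (ContinuousLinearMap.id ℝ C(Fin n → unitInterval, ∀ a, E a)) φ := by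
    have : (radialDefect S xbar v G ∘ fun ψ => ((0 : Fin n → ℝ), ψ)) =
        fun ψ => ψ - v.comp (const _ xbar) := by
      funext ψ
      simp [radialDefect]
    rw [this]
    exact (hasFDerivAt_id φ).sub_const _
  rw [hd.unique hd']
  exact ⟨ContinuousLinearEquiv.refl ℝ _, rfl⟩

/-- The radial integral equation has solutions for small parameters, and they are consistent. -/
theorem exists_radialDefect_eq_zero [∀ a, CompleteSpace (E a)] (S : ι → Finset (Fin n))
    (xbar : Fin n → ℝ) (v : C(Fin n → ℝ, ∀ a, E a)) (hv : ContDiff ℝ 2 v)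
    (G : C((Fin n → ℝ) × (∀ a, E a), (Fin n → ℝ) →L[ℝ] (∀ a, E a))) (hG : ContDiff ℝ 2 G) :
    ∃ ψ : (Fin n → ℝ) → C(Fin n → unitInterval, ∀ a, E a),
      ContDiffAt ℝ 2 ψ 0 ∧ ψ 0 = const _ (v xbar) ∧
      ∃ δ > 0, ∀ z, ‖z‖ < δ → radialDefect S xbar v G (z, ψ z) = 0 ∧
        ∀ τ t, ψ (cubeScale z τ) t = ψ z (τ * t) := by
  set φ₀ : C(Fin n → unitInterval, ∀ a, E a) := const _ (v xbar) with hφ₀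
  have hc : ContDiffAt ℝ 2 (radialDefect S xbar v G) (0, φ₀) :=
    (contDiff_radialDefect S xbar v hv G hG).contDiffAt
  have hinv := isInvertible_fderiv_radialDefect S xbar v hv G hG φ₀
  have h0 : radialDefect S xbar v G (0, φ₀) = 0 := by
    ext t a
    simp [radialDefect, hφ₀]
  set ψ := hc.implicitFunction two_ne_zero hinv with hψ
  have hψ0 : ψ 0 = φ₀ := hc.implicitFunction_apply_self two_ne_zero hinv
  have hψc : ContDiffAt ℝ 2 ψ 0 := hc.contDiffAt_implicitFunction two_ne_zero hinv
  refine ⟨ψ, hψc, hψ0, ?_⟩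
  obtain ⟨ε, hε, h1⟩ := Metric.eventually_nhds_iff_ball.1
    (hc.eventually_apply_eq_iff_implicitFunction two_ne_zero hinv)
  obtain ⟨δ, hδ, h2⟩ := Metric.eventually_nhds_iff_ball.1
    ((hc.eventually_apply_implicitFunction two_ne_zero hinv).and
      (hψc.continuousAt (Metric.ball_mem_nhds (ψ 0) hε)))
  -- `δ` gives the equation and keeps `ψ z` within `ε` of `φ₀`; `ε` keeps `(τ z, ψ z (τ ·))` in the
  -- ball where zeros are unique. That pair is also a zero, so `ψ z (τ ·) = ψ (τ z)`.
  refine ⟨min δ ε, lt_min hδ hε, fun z hz => ?_⟩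
  obtain ⟨h3, h4⟩ := h2 z (mem_ball_zero_iff.2 (hz.trans_le (min_le_left _ _)))
  rw [h0] at h3
  refine ⟨h3, fun τ t => ?_⟩
  have hcomp := radialDefect_comp S xbar v G z (ψ z) τ
  rw [h3] at hcomp
  have hmem : (cubeScale z τ, (ψ z).comp ⟨fun t => τ * t, by fun_prop⟩) ∈
      Metric.ball ((0 : Fin n → ℝ), φ₀) ε := by
    rw [← ball_prod_same, Set.mem_prod]
    refine ⟨mem_ball_zero_iff.2 ((norm_cubeScale_apply_le z τ).trans_lt
      (hz.trans_le (min_le_right _ _))), ?_⟩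
    have h4' : dist (ψ z) φ₀ < ε := by rw [← hψ0]; exact h4
    refine (ContinuousMap.dist_lt_iff (f := (ψ z).comp ⟨fun t => τ * t, by fun_prop⟩)
      (g := φ₀) hε).2 fun t => ?_
    exact (ContinuousMap.dist_apply_le_dist (f := ψ z) (g := φ₀) (τ * t)).trans_lt h4'
  have h5 := (h1 _ hmem).1 (by rw [hcomp, h0]; rfl)
  exact congrArg (fun f : C(Fin n → unitInterval, ∀ a, E a) => f t) h5

end RadialIntegralEquation

/-! ### From the integral equation to radial derivatives -/

section RadialSolution

open ContinuousMap

variable {n : ℕ} {ι : Type*} [Fintype ι] {E : ι → Type*} [∀ a, NormedAddCommGroup (E a)]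
  [∀ a, NormedSpace ℝ (E a)] [∀ a, CompleteSpace (E a)]

theorem shrink_shrink (A : Finset (Fin n)) {l s : ℝ} (hl : l ∈ Set.Icc (0 : ℝ) 1)
    (hs : s ∈ Set.Icc (0 : ℝ) 1) (t : Fin n → unitInterval) :
    shrink A (s, shrink A (l, t)) = shrink A (l * s, t) := by
  have hls : l * s ∈ Set.Icc (0 : ℝ) 1 :=
    ⟨mul_nonneg hl.1 hs.1, mul_le_one₀ hl.2 hs.1 hs.2⟩
  ext i
  simp only [shrink, ContinuousMap.coe_mk]
  split_ifs
  · simp only [Set.projIcc_of_mem _ hl, Set.projIcc_of_mem _ hs, Set.projIcc_of_mem _ hls,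
      Set.Icc.coe_mul]
    ring
  · rfl

theorem cubeScale_shrink (A : Finset (Fin n)) {l : ℝ} (hl : l ∈ Set.Icc (0 : ℝ) 1)
    (z : Fin n → ℝ) : cubeScale z (shrink A (l, 1)) = z + (l - 1) • coordProj A z := by
  ext i
  simp only [cubeScale_apply, shrink, ContinuousMap.coe_mk, Pi.add_apply, Pi.smul_apply,
    coordProj_apply, smul_eq_mul]
  split_ifs
  · simp only [Set.projIcc_of_mem _ hl, Pi.one_apply, mul_one]
    ring
  · simp

theorem coordProj_cubeScale_shrink (A : Finset (Fin n)) {l : ℝ} (hl : l ∈ Set.Icc (0 : ℝ) 1)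
    (z : Fin n → ℝ) : coordProj A (cubeScale z (shrink A (l, 1))) = l • coordProj A z := by
  rw [cubeScale_shrink A hl, map_add, map_smul, coordProj_coordProj, sub_smul, one_smul,
    add_sub_cancel]

/-- There is a `C²` function whose components have prescribed derivatives in partially radial
directions, and prescribed values where the respective coordinates agree with those of `xbar`. -/
theorem exists_radial_solution (S : ι → Finset (Fin n)) (xbar : Fin n → ℝ)
    (v : (Fin n → ℝ) → ∀ a, E a) (hv : ContDiff ℝ 2 v)
    (hvS : ∀ a x x', (∀ i ∉ S a, x i = x' i) → v x a = v x' a)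
    (G : (Fin n → ℝ) × (∀ a, E a) → (Fin n → ℝ) →L[ℝ] (∀ a, E a)) (hG : ContDiff ℝ 2 G) :
    ∃ U : (Fin n → ℝ) → ∀ a, E a, ContDiffAt ℝ 2 U xbar ∧ U xbar = v xbar ∧
      ∀ᶠ x in 𝓝 xbar, ∀ a, ((∀ i ∈ S a, x i = xbar i) → U x a = v x a) ∧
        fderiv ℝ (fun y => U y a) x (coordProj (S a) (x - xbar)) =
          G (x, U x) (coordProj (S a) (x - xbar)) a := by
  obtain ⟨ψ, hψ, hψ0, δ, hδ, hsol⟩ := exists_radialDefect_eq_zero S xbar ⟨v, hv.continuous⟩ hv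
    ⟨G, hG.continuous⟩ hG
  let ev : C(Fin n → unitInterval, ∀ a, E a) →L[ℝ] (∀ a, E a) := ContinuousMap.evalCLM ℝ 1
  have hUc : ContDiffAt ℝ 2 (fun x => ψ (x - xbar) 1) xbar := by
    have h1 : ContDiffAt ℝ 2 ψ (xbar - xbar) := by rwa [sub_self]
    have h2 : ContDiffAt ℝ 2 (fun x => ψ (x - xbar)) xbar :=
      ContDiffAt.comp (f := fun x => x - xbar) xbar h1 (contDiffAt_id.sub contDiffAt_const)
    exact ContDiffAt.comp (f := fun x => ψ (x - xbar)) (g := ev) xbar ev.contDiff.contDiffAt h2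
  refine ⟨fun x => ψ (x - xbar) 1, hUc, by simp [hψ0], ?_⟩
  filter_upwards [Metric.ball_mem_nhds xbar hδ, hUc.eventually (by simp)] with x hx hxd a
  rw [mem_ball_iff_norm] at hx
  set z := x - xbar with hz
  have hxz : xbar + z = x := by rw [hz]; exact add_sub_cancel xbar x
  obtain ⟨h0, hcons⟩ := hsol z hx
  set τ : ℝ → Fin n → unitInterval := fun l => shrink (S a) (l, 1) with hτ
  have hτ1 : τ 1 = 1 := by
    ext i
    simp only [hτ, shrink, ContinuousMap.coe_mk]
    split_ifs <;> simp
  have hU : ∀ t, ψ (cubeScale z t) 1 = ψ z t := fun t => by rw [hcons, mul_one]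
  set h : ℝ → E a := fun s => G (xbar + cubeScale z (τ s), ψ z (τ s)) (coordProj (S a) z) a with hh
  have hhc : Continuous h := by
    have h1 : Continuous τ := by fun_prop
    have h2 : Continuous fun s => G (xbar + cubeScale z (τ s), ψ z (τ s)) :=
      hG.continuous.comp (by fun_prop)
    fun_prop
  -- The integral equation at the cube point `τ l`: two shrinkings compose to the factor `l * s`,
  -- and substituting it for `s` absorbs the factor `l` of the direction vector.
  have hint : ∀ l ∈ Set.Icc (0 : ℝ) 1, ψ z (τ l) a = v x a + ∫ s in (0 : ℝ)..l, h s := by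
    intro l hl
    have h1 := congrFun (congrArg (fun f : C(Fin n → unitInterval, ∀ a, E a) => f (τ l)) h0) a
    simp only [radialDefect, ContinuousMap.sub_apply, Pi.sub_apply, ContinuousMap.comp_apply,
      pointwiseApply_apply, radialAverage_apply, cubePair_apply, ContinuousMap.add_apply,
      ContinuousMap.coe_mk, ContinuousMap.const_apply, ContinuousMap.zero_apply,
      Pi.zero_apply] at h1
    have h2 : v (xbar + cubeScale z (τ l)) a = v x a := by
      refine hvS a _ _ fun i hi => ?_
      rw [hτ, cubeScale_shrink _ hl, ← hxz]
      simp [coordProj_apply, hi]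
    have h3 : ∀ s ∈ Set.uIcc (0 : ℝ) 1, G (xbar + cubeScale z (shrink (S a) (s, τ l)),
        ψ z (shrink (S a) (s, τ l))) (coordProj (S a) (cubeScale z (τ l))) a = l • h (l * s) := by
      intro s hs
      rw [Set.uIcc_of_le zero_le_one] at hs
      simp only [hτ, hh]
      rw [shrink_shrink _ hl hs, coordProj_cubeScale_shrink _ hl, map_smul, Pi.smul_apply]
    rw [h2, intervalIntegral.integral_congr h3, intervalIntegral.integral_smul,
      intervalIntegral.smul_integral_comp_mul_left, mul_zero, mul_one] at h1
    rw [sub_sub, sub_eq_zero] at h1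
    exact h1
  have hUx : ψ z 1 a = v x a + ∫ s in (0 : ℝ)..1, h s := by
    have := hint 1 (by simp)
    rwa [hτ1] at this
  refine ⟨fun hxS => ?_, ?_⟩
  · have hz0 : coordProj (S a) z = 0 := by
      ext i
      rw [coordProj_apply]
      split_ifs with hi
      · simp [hz, hxS i hi]
      · rfl
    rw [hUx]
    simp [hh, hz0]
  · have hd : HasFDerivAt (fun y => ψ (y - xbar) 1 a)
        (fderiv ℝ (fun y => ψ (y - xbar) 1 a) x) x :=
      (differentiableAt_pi.1 (hxd.differentiableAt two_ne_zero) a).hasFDerivAt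
    have hline : HasDerivAt (fun l : ℝ => x + (l - 1) • coordProj (S a) z)
        (coordProj (S a) z) 1 := by
      simpa using (((hasDerivAt_id (1 : ℝ)).sub_const 1).smul_const
        (coordProj (S a) z)).const_add x
    have hd1 := HasFDerivAt.comp_hasDerivAt_of_eq (1 : ℝ) hd hline (by simp)
    have hd2 : HasDerivAt (fun l : ℝ => v x a + ∫ s in (0 : ℝ)..l, h s) (h 1) 1 :=
      (intervalIntegral.integral_hasDerivAt_right (hhc.intervalIntegrable _ _)
        hhc.stronglyMeasurable.stronglyMeasurableAtFilter hhc.continuousAt).const_add _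
    have heq : ∀ l ∈ Set.Icc (0 : ℝ) 1,
        ((fun y => ψ (y - xbar) 1 a) ∘ fun l : ℝ => x + (l - 1) • coordProj (S a) z) l =
          v x a + ∫ s in (0 : ℝ)..l, h s := by
      intro l hl
      rw [← hint l hl, ← hU (τ l), hτ, cubeScale_shrink _ hl]
      simp only [Function.comp_apply]
      rw [hz, add_sub_right_comm]
    -- The integral formula holds only for `l ∈ [0, 1]`, so the two derivatives are compared at `l =
    -- 1` as one-sided ones.
    have hd3 := hd2.hasDerivWithinAt (s := Set.Icc 0 1) |>.congr heq (heq 1 (by simp))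
    have huniq := (uniqueDiffOn_Icc_zero_one 1 (by simp)).eq_deriv _
      (hd1.hasDerivWithinAt (s := Set.Icc 0 1)) hd3
    rw [huniq, hh]
    simp only [hτ1]
    rw [← hU 1, show cubeScale z 1 = z by ext i; simp [cubeScale_apply], hxz]

end RadialSolution

/-! ### The radial equations of a multi-index system -/

namespace MultiIndexSystem

variable {n : ℕ} (S : MultiIndexSystem n)

/-- The right-hand side `F^I_i(x; U^I_i)`, extended by `0` to indices `i ∉ I`. -/
noncomputable def rhsExt (I : S.idx) (i : Fin n) (p : (Fin n → ℝ) × S.Unknowns) :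
    Fin (S.dim I) → ℝ :=
  if hi : i ∈ I.1 then S.rhs I i hi p else 0

theorem rhsExt_of_mem {I : S.idx} {i : Fin n} (hi : i ∈ I.1) : S.rhsExt I i = S.rhs I i hi := by
  funext p
  simp [rhsExt, hi]

theorem rhsExt_of_notMem {I : S.idx} {i : Fin n} (hi : i ∉ I.1) : S.rhsExt I i = fun _ => 0 := by
  funext p
  simp [rhsExt, hi]

/-- The restriction of the unknowns, as a continuous linear map. -/
noncomputable def restrL (I : S.idx) (i : Fin n) : ((Fin n → ℝ) × S.Unknowns) →L[ℝ]
    ((Fin n → ℝ) × ((J : S.Deps I i) → Fin (S.dim J.1) → ℝ)) :=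
  (ContinuousLinearMap.fst ℝ _ _).prod
    (ContinuousLinearMap.pi fun J => (ContinuousLinearMap.proj J.1).comp
      (ContinuousLinearMap.snd ℝ _ _))

variable {S} {Ω : Set ((Fin n → ℝ) × S.Unknowns)}

theorem IsC2On.contDiffAt_rhsExt (hF : S.IsC2On Ω) {p : (Fin n → ℝ) × S.Unknowns} (hp : p ∈ Ω)
    (I : S.idx) (i : Fin n) : ContDiffAt ℝ 2 (S.rhsExt I i) p := by
  by_cases hi : i ∈ I.1
  · rw [S.rhsExt_of_mem hi]
    exact ContDiffAt.comp (f := S.restrL I i) p (hF p hp I i hi)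
      (S.restrL I i).contDiff.contDiffAt
  · rw [S.rhsExt_of_notMem hi]
    exact contDiffAt_const

theorem IsC2On.fderiv_rhsExt (hF : S.IsC2On Ω) {p : (Fin n → ℝ) × S.Unknowns} (hp : p ∈ Ω)
    {I : S.idx} {i : Fin n} (hi : i ∈ I.1) (q : (Fin n → ℝ) × S.Unknowns) :
    fderiv ℝ (S.rhsExt I i) p q = fderiv ℝ (S.F I i hi) (S.restr I i p) (S.restr I i q) := by
  rw [S.rhsExt_of_mem hi]
  have h := HasFDerivAt.comp (f := S.restrL I i) p
    ((hF p hp I i hi).differentiableAt two_ne_zero).hasFDerivAt (S.restrL I i).hasFDerivAt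
  exact congrArg (fun L => L q) h.fderiv

theorem IsC2On.fderiv_rhsExt_eq_zero (hF : S.IsC2On Ω) {p : (Fin n → ℝ) × S.Unknowns}
    (hp : p ∈ Ω) {I : S.idx} {i : Fin n} (hi : i ∈ I.1) (w : S.Unknowns)
    (hw : ∀ J : S.Deps I i, w J.1 = 0) : fderiv ℝ (S.rhsExt I i) p (0, w) = 0 := by
  rw [hF.fderiv_rhsExt hp hi, show S.restr I i (0, w) = 0 from
    Prod.ext rfl (funext hw), map_zero]

/-- `F^I_i` sees only the `u^J` with `J ⊇ I ∖ i`, all of which contain `j`. Hence the zeros that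
`rhsExt` puts in the other components do not matter. -/
theorem IsC2On.crossDeriv_eq (hF : S.IsC2On Ω) {p : (Fin n → ℝ) × S.Unknowns}
    (hp : p ∈ Ω) {I : S.idx} {i j : Fin n} (hi : i ∈ I.1) (hj : j ∈ I.1) (hij : i ≠ j) :
    S.crossDeriv I i j hi hj hij p =
      fderiv ℝ (S.rhsExt I i) p (Pi.single j 1, fun J => S.rhsExt J j p) := by
  classical
  rw [hF.fderiv_rhsExt hp hi]
  have h : S.restr I i (Pi.single j 1, fun J => S.rhsExt J j p) =
      (Pi.single j 1, 0) + ∑ J : S.Deps I i,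
        ((0 : Fin n → ℝ), Pi.single J (S.rhs J.1 j (S.mem_of_deps hj hij J) p)) := by
    refine Prod.ext ?_ ?_
    · simp [restr, Prod.fst_sum]
    · simp only [restr, Prod.snd_add, Prod.snd_sum, zero_add]
      rw [Finset.univ_sum_single]
      funext J
      rw [S.rhsExt_of_mem (S.mem_of_deps hj hij J)]
  rw [h, map_add, map_sum]
  rfl

/-- Data and right-hand sides are replaced by globally `C²` functions that agree with them near the
base point; by continuity of `U` the replacement is invisible near `xbar`. -/
theorem IsC2On.exists_radial_solution (hF : S.IsC2On Ω) {xbar : Fin n → ℝ}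
    {Ubar : S.Unknowns} (hmem : (xbar, Ubar) ∈ Ω) {ubar : S.Data}
    (hu : ∀ I, ContDiffAt ℝ 2 (ubar I) (S.compl I xbar))
    (hbar : ∀ I, ubar I (S.compl I xbar) = Ubar I) :
    ∃ U : (Fin n → ℝ) → S.Unknowns, ContDiffAt ℝ 2 U xbar ∧ U xbar = Ubar ∧
      ∀ᶠ x in 𝓝 xbar, ∀ I : S.idx,
        ((∀ i ∈ I.1, x i = xbar i) → U x I = ubar I (S.compl I x)) ∧
        fderiv ℝ (fun y => U y I) x (coordProj I.1 (x - xbar)) =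
          ∑ i, (coordProj I.1 (x - xbar) i) • S.rhsExt I i (x, U x) := by
  choose g hg hgu using fun I => (hu I).exists_contDiff_two_eventuallyEq
  choose r hr hrF using fun (I : S.idx) (i : Fin n) =>
    (hF.contDiffAt_rhsExt hmem I i).exists_contDiff_two_eventuallyEq
  let v : (Fin n → ℝ) → S.Unknowns := fun x I => g I (S.compl I x)
  have hcompl : ∀ I : S.idx, ContDiff ℝ 2 (S.compl I) := fun I =>
    contDiff_pi.2 fun j => contDiff_apply ℝ ℝ j.1
  have hv : ContDiff ℝ 2 v := contDiff_pi.2 fun I => (hg I).comp (hcompl I)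
  have hvbar : v xbar = Ubar := by
    funext I
    rw [← hbar I]
    exact (hgu I).eq_of_nhds
  let G : (Fin n → ℝ) × S.Unknowns → (Fin n → ℝ) →L[ℝ] S.Unknowns := fun p =>
    ContinuousLinearMap.pi fun I => ∑ i, (ContinuousLinearMap.proj i).smulRight (r I i p)
  have hGapply : ∀ p w I, G p w I = ∑ i, w i • r I i p := fun p w I => by simp [G]
  have hG : ContDiff ℝ 2 G := by
    refine contDiff_clm_apply_iff.2 fun w => contDiff_pi.2 fun I => ?_
    simp only [hGapply]
    exact ContDiff.sum fun i _ => (hr I i).const_smul (w i)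
  obtain ⟨U, hU, hU0, hrad⟩ := _root_.exists_radial_solution (fun I : S.idx => I.1) xbar v hv
    (fun I x x' hx => congrArg (g I) (funext fun j => hx j.1 j.2)) G hG
  rw [hvbar] at hU0
  refine ⟨U, hU, hU0, ?_⟩
  have h1 : ∀ᶠ x in 𝓝 xbar, ∀ I, g I (S.compl I x) = ubar I (S.compl I x) :=
    Filter.eventually_all.2 fun I => (hcompl I).continuous.continuousAt.eventually (hgu I)
  have hgraph : ContinuousAt (fun x => (x, U x)) xbar := continuousAt_id.prodMk hU.continuousAt
  have h2 : ∀ᶠ x in 𝓝 xbar, ∀ I i, r I i (x, U x) = S.rhsExt I i (x, U x) :=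
    Filter.eventually_all.2 fun I => Filter.eventually_all.2 fun i =>
      hgraph.eventually (p := fun p => r I i p = S.rhsExt I i p)
        (by simp only [hU0]; exact hrF I i)
  filter_upwards [hrad, h1, h2] with x hx hx1 hx2 I
  refine ⟨fun hI => ((hx I).1 hI).trans (hx1 I), (hx I).2.trans ?_⟩
  rw [hGapply]
  simp only [hx2]

end MultiIndexSystem

/-- Balls are cubes in the sup norm, and each coordinate of `x - xbar` is either kept or multiplied
by `s`. -/
theorem add_smul_coordProj_mem_closedBall {n : ℕ} (A : Finset (Fin n)) {xbar x : Fin n → ℝ} {r : ℝ}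
    (hx : x ∈ Metric.closedBall xbar r) {s : ℝ} (hs : s ∈ Set.Icc (0 : ℝ) 1) :
    x + (s - 1) • coordProj A (x - xbar) ∈ Metric.closedBall xbar r := by
  rw [mem_closedBall_iff_norm] at hx ⊢
  refine le_trans ((pi_norm_le_iff_of_nonneg (norm_nonneg _)).2 fun i => ?_) hx
  refine le_trans ?_ (norm_le_pi_norm (x - xbar) i)
  simp only [Pi.sub_apply, Pi.add_apply, Pi.smul_apply, coordProj_apply, smul_eq_mul]
  split_ifs
  · rw [show x i + (s - 1) * (x i - xbar i) - xbar i = s * (x i - xbar i) by ring, norm_mul,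
      Real.norm_of_nonneg hs.1]
    exact mul_le_of_le_one_left (norm_nonneg _) hs.2
  · simp

theorem hasDerivAt_add_smul {X : Type*} [NormedAddCommGroup X] [NormedSpace ℝ X] (x z : X)
    (s : ℝ) : HasDerivAt (fun s : ℝ => x + (s - 1) • z) z s := by
  have h := (((hasDerivAt_id s).sub_const 1).smul_const z).const_add x
  rw [one_smul] at h
  exact h

/-- A function `δ` for which `δ + Dδ · z` is bounded, where `z` is the vector of some of the
coordinates of `x - xbar`, obeys the same bound. -/
theorem norm_le_of_norm_add_radial_fderiv_le {n : ℕ} {F : Type*} [NormedAddCommGroup F]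
    [NormedSpace ℝ F] (A : Finset (Fin n)) {xbar : Fin n → ℝ} {r C : ℝ} {δ : (Fin n → ℝ) → F}
    (hδ : ∀ x ∈ Metric.closedBall xbar r, DifferentiableAt ℝ δ x)
    (hC : ∀ x ∈ Metric.closedBall xbar r, ‖δ x + fderiv ℝ δ x (coordProj A (x - xbar))‖ ≤ C)
    {x : Fin n → ℝ} (hx : x ∈ Metric.closedBall xbar r) : ‖δ x‖ ≤ C := by
  set z := coordProj A (x - xbar) with hz
  set c : ℝ → Fin n → ℝ := fun s => x + (s - 1) • z with hc
  have hcmem : ∀ s ∈ Set.Icc (0 : ℝ) 1, c s ∈ Metric.closedBall xbar r :=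
    fun s hs => add_smul_coordProj_mem_closedBall A hx hs
  have hcproj : ∀ s, coordProj A (c s - xbar) = s • z := by
    intro s
    have : c s - xbar = (x - xbar) + (s - 1) • z := by simp only [hc]; abel
    rw [this, map_add, map_smul, hz, coordProj_coordProj, sub_smul, one_smul, add_sub_cancel]
  have hcd : ∀ s, HasDerivAt c z s := hasDerivAt_add_smul x z
  -- Since the `A`-part of `c s - xbar` is `s • z`, the bounded expression is exactly the derivative
  -- of `s • δ (c s)`, which vanishes at `s = 0` and equals `δ x` at `s = 1`.
  have hg : ∀ s ∈ Set.Icc (0 : ℝ) 1, HasDerivWithinAt (fun s => s • δ (c s))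
      (δ (c s) + fderiv ℝ δ (c s) (coordProj A (c s - xbar))) (Set.Icc 0 1) s := by
    intro s hs
    have h1 := (hδ _ (hcmem s hs)).hasFDerivAt.comp_hasDerivAt s (hcd s)
    have h2 := (hasDerivAt_id s).smul h1
    rw [hcproj, map_smul, add_comm]
    rw [one_smul] at h2
    exact h2.hasDerivWithinAt
  have h := norm_image_sub_le_of_norm_deriv_le_segment_01' (C := C) hg
    fun s hs => hC _ (hcmem s (Set.Ico_subset_Icc_self hs))
  simpa [hc] using h

/-! ### Vanishing of the defects -/

namespace MultiIndexSystem

variable {n : ℕ} {S : MultiIndexSystem n} {Ω : Set ((Fin n → ℝ) × S.Unknowns)}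

/-- The defects `u^I_{x_i} - F^I_i(x; U^I_i)`, extended by `0` to indices `i ∉ I`. -/
noncomputable def defect (U : (Fin n → ℝ) → S.Unknowns) (i : Fin n) (x : Fin n → ℝ) :
    S.Unknowns :=
  fun I => if i ∈ I.1 then fderiv ℝ U x (Pi.single i 1) I - S.rhsExt I i (x, U x) else 0

theorem hasFDerivAt_defect (hF : S.IsC2On Ω) {U : (Fin n → ℝ) → S.Unknowns} {x : Fin n → ℝ}
    (hU : ContDiffAt ℝ 2 U x) (hx : (x, U x) ∈ Ω) {I : S.idx} {i : Fin n} (hi : i ∈ I.1) :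
    HasFDerivAt (fun y => defect U i y I)
      ((ContinuousLinearMap.proj I).comp
          ((fderiv ℝ (fderiv ℝ U) x).flip (Pi.single i 1)) -
        (fderiv ℝ (S.rhsExt I i) (x, U x)).comp
          ((ContinuousLinearMap.id ℝ _).prod (fderiv ℝ U x))) x := by
  have h1 : HasFDerivAt (fderiv ℝ U) (fderiv ℝ (fderiv ℝ U) x) x :=
    ((hU.fderiv_right (m := 1) (by norm_num)).differentiableAt one_ne_zero).hasFDerivAt
  have h2 : HasFDerivAt U (fderiv ℝ U x) x := (hU.differentiableAt two_ne_zero).hasFDerivAt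
  have h3 : HasFDerivAt (fun y => (y, U y)) ((ContinuousLinearMap.id ℝ _).prod (fderiv ℝ U x)) x :=
    (hasFDerivAt_id x).prodMk h2
  have h4 := HasFDerivAt.comp (f := fun y => (y, U y)) x
    ((hF.contDiffAt_rhsExt hx I i).differentiableAt two_ne_zero).hasFDerivAt h3
  have h5 : HasFDerivAt (fun y => fderiv ℝ U y (Pi.single i 1))
      ((fderiv ℝ (fderiv ℝ U) x).flip (Pi.single i 1)) x := by
    simpa using h1.clm_apply (hasFDerivAt_const (Pi.single i (1 : ℝ) : Fin n → ℝ) x)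
  have h6 := (ContinuousLinearMap.proj (R := ℝ) (φ := fun I : S.idx => Fin (S.dim I) → ℝ)
    I).hasFDerivAt.comp x h5
  have h7 : (fun y => defect U i y I) = fun y =>
      fderiv ℝ U y (Pi.single i 1) I - S.rhsExt I i (y, U y) := by
    funext y
    simp [defect, hi]
  rw [h7]
  exact h6.sub h4

theorem differentiableAt_defect (hF : S.IsC2On Ω) {U : (Fin n → ℝ) → S.Unknowns} {x : Fin n → ℝ}
    (hU : ContDiffAt ℝ 2 U x) (hx : (x, U x) ∈ Ω) (I : S.idx) (i : Fin n) :
    DifferentiableAt ℝ (fun y => defect U i y I) x := by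
  by_cases hi : i ∈ I.1
  · exact (hasFDerivAt_defect hF hU hx hi).differentiableAt
  · have : (fun y => defect U i y I) = fun _ => 0 := by
      funext y
      simp [defect, hi]
    rw [this]
    exact differentiableAt_const _

/-- By the integrability conditions, the mixed derivatives of the right-hand sides along `U`
differ by terms that are linear in the defects. -/
theorem IsDarbouxOn.fderiv_rhsExt_sub (hD : S.IsDarbouxOn Ω) (hF : S.IsC2On Ω)
    {U : (Fin n → ℝ) → S.Unknowns} {x : Fin n → ℝ} (hx : (x, U x) ∈ Ω)
    {I : S.idx} {i j : Fin n} (hi : i ∈ I.1) (hj : j ∈ I.1) (hij : i ≠ j) :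
    fderiv ℝ (S.rhsExt I i) (x, U x) (Pi.single j 1, fderiv ℝ U x (Pi.single j 1)) -
        fderiv ℝ (S.rhsExt I j) (x, U x) (Pi.single i 1, fderiv ℝ U x (Pi.single i 1)) =
      fderiv ℝ (S.rhsExt I i) (x, U x) (0, defect U j x) -
        fderiv ℝ (S.rhsExt I j) (x, U x) (0, defect U i x) := by
  have key : ∀ {i j : Fin n} (hi : i ∈ I.1) (hj : j ∈ I.1) (hij : i ≠ j),
      fderiv ℝ (S.rhsExt I i) (x, U x) (Pi.single j 1, fderiv ℝ U x (Pi.single j 1)) =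
        S.crossDeriv I i j hi hj hij (x, U x) +
          fderiv ℝ (S.rhsExt I i) (x, U x) (0, defect U j x) := by
    intro i j hi hj hij
    rw [hF.crossDeriv_eq hx hi hj hij, ← map_add, ← sub_eq_zero, ← map_sub]
    have : ((Pi.single j 1, fderiv ℝ U x (Pi.single j 1)) : (Fin n → ℝ) × S.Unknowns) -
        ((Pi.single j 1, fun J => S.rhsExt J j (x, U x)) + (0, defect U j x)) =
        (0, fderiv ℝ U x (Pi.single j 1) - ((fun J => S.rhsExt J j (x, U x)) + defect U j x)) := by
      ext1 <;> simp
    rw [this]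
    -- Only the components `J ∋ j` matter here, and for them `u^J_{x_j} = F^J_j + defect` holds by
    -- definition.
    refine hF.fderiv_rhsExt_eq_zero hx hi _ fun J => ?_
    have hJ := S.mem_of_deps hj hij J
    simp [defect, hJ]
  rw [key hi hj hij, key hj hi hij.symm, hD _ hx I i j hi hj hij]
  abel

theorem sum_coordProj_smul_defect {U : (Fin n → ℝ) → S.Unknowns} {xbar x : Fin n → ℝ}
    {I : S.idx}
    (h : fderiv ℝ U x (coordProj I.1 (x - xbar)) I =
      ∑ i, (coordProj I.1 (x - xbar) i) • S.rhsExt I i (x, U x)) :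
    ∑ i, (coordProj I.1 (x - xbar) i) • defect U i x I = 0 := by
  have h1 : fderiv ℝ U x (coordProj I.1 (x - xbar)) I =
      ∑ i, (coordProj I.1 (x - xbar) i) • fderiv ℝ U x (Pi.single i 1) I := by
    conv_lhs => rw [pi_eq_sum_univ' (coordProj I.1 (x - xbar))]
    rw [map_sum, Finset.sum_apply]
    refine Finset.sum_congr rfl fun i _ => ?_
    rw [map_smul, Pi.smul_apply]
  rw [h1, ← sub_eq_zero, ← Finset.sum_sub_distrib] at h
  rw [← h]
  refine Finset.sum_congr rfl fun i _ => ?_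
  by_cases hi : i ∈ I.1
  · simp [defect, hi, smul_sub]
  · simp [coordProj_apply, hi]

/-- Differentiate the identity `∑ z_j D_j = 0` in the direction `e_i`. In `∂_i D_j - ∂_j D_i` the
second derivatives of `U` cancel by symmetry, and integrability leaves terms linear in the defects.
-/
theorem defect_add_fderiv_defect (hF : S.IsC2On Ω) (hD : S.IsDarbouxOn Ω)
    {U : (Fin n → ℝ) → S.Unknowns} {xbar x : Fin n → ℝ}
    (hU : ContDiffAt ℝ 2 U x) (hx : (x, U x) ∈ Ω) {I : S.idx}
    (h : ∀ᶠ y in 𝓝 x, fderiv ℝ U y (coordProj I.1 (y - xbar)) I =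
      ∑ i, (coordProj I.1 (y - xbar) i) • S.rhsExt I i (y, U y)) {i : Fin n} (hi : i ∈ I.1) :
    defect U i x I + fderiv ℝ (fun y => defect U i y I) x (coordProj I.1 (x - xbar)) =
      ∑ j, (coordProj I.1 (x - xbar) j) •
        (fderiv ℝ (S.rhsExt I j) (x, U x) (0, defect U i x) -
          fderiv ℝ (S.rhsExt I i) (x, U x) (0, defect U j x)) := by
  classical
  set z := coordProj I.1 (x - xbar) with hz
  have hd := fun j => (differentiableAt_defect hF hU hx I j).hasFDerivAt
  have hsum : HasFDerivAt
      (fun y => ∑ j, (coordProj I.1 (y - xbar) j) • defect U j y I)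
      (∑ j, (z j • fderiv ℝ (fun y => defect U j y I) x +
        ((ContinuousLinearMap.proj j).comp (coordProj I.1)).smulRight (defect U j x I))) x := by
    refine HasFDerivAt.fun_sum fun j _ => ?_
    have h1 : HasFDerivAt (fun y => coordProj I.1 (y - xbar) j)
        ((ContinuousLinearMap.proj j).comp (coordProj I.1)) x := by
      let L : (Fin n → ℝ) →L[ℝ] ℝ := (ContinuousLinearMap.proj j).comp (coordProj I.1)
      have hL : HasFDerivAt (fun y => L (y - xbar)) (L.comp (ContinuousLinearMap.id ℝ _)) x :=
        L.hasFDerivAt.comp x ((hasFDerivAt_id x).sub_const xbar)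
      exact hL
    exact h1.smul (hd j)
  have hzero := hsum.unique ((hasFDerivAt_const (0 : Fin (S.dim I) → ℝ) x).congr_of_eventuallyEq
    (h.mono fun y hy => sum_coordProj_smul_defect hy))
  have hzero' := congrArg (fun L => L (Pi.single i 1)) hzero
  have hei : coordProj I.1 (Pi.single i 1) = Pi.single i 1 := by
    ext j
    rw [coordProj_apply]
    split_ifs with hj
    · rfl
    · rw [Pi.single_eq_of_ne (by rintro rfl; exact hj hi)]
  simp only [_root_.sum_apply, _root_.add_apply, _root_.smul_apply,
    ContinuousLinearMap.smulRight_apply, ContinuousLinearMap.comp_apply,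
    ContinuousLinearMap.proj_apply, hei, _root_.zero_apply,
    Finset.sum_add_distrib] at hzero'
  have h2 : ∑ j, (Pi.single i (1 : ℝ) : Fin n → ℝ) j • defect U j x I = defect U i x I := by
    rw [Finset.sum_eq_single i]
    · simp
    · intro j _ hj
      simp [hj]
    · simp
  rw [h2, add_comm] at hzero'
  have h3 : fderiv ℝ (fun y => defect U i y I) x z =
      ∑ j, z j • fderiv ℝ (fun y => defect U i y I) x (Pi.single j 1) := by
    conv_lhs => rw [pi_eq_sum_univ' z, map_sum]
    refine Finset.sum_congr rfl fun j _ => ?_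
    rw [map_smul]
  rw [eq_neg_of_add_eq_zero_left hzero', h3, neg_add_eq_sub, ← Finset.sum_sub_distrib]
  refine Finset.sum_congr rfl fun j _ => ?_
  rw [← smul_sub]
  by_cases hj : j ∈ I.1
  swap
  · simp [hz, coordProj_apply, hj]
  congr 1
  by_cases hij : i = j
  · subst hij; simp
  rw [(hasFDerivAt_defect hF hU hx hi).fderiv, (hasFDerivAt_defect hF hU hx hj).fderiv]
  have hsymm := (hU.isSymmSndFDerivAt (by simp)) (Pi.single i 1) (Pi.single j 1)
  have h4 := hD.fderiv_rhsExt_sub hF hx hi hj hij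
  simp only [_root_.sub_apply, ContinuousLinearMap.comp_apply,
    ContinuousLinearMap.flip_apply, ContinuousLinearMap.proj_apply,
    ContinuousLinearMap.prod_apply, ContinuousLinearMap.id_apply]
  rw [hsymm, sub_sub_sub_cancel_left, ← neg_sub, h4, neg_sub]

/-- The maximum `M` of the defects on the closed ball satisfies `M ≤ n r (2C) M ≤ M / 2`. The larger
radius `R` makes the radial equations hold near each point of that ball, so that they can be
differentiated. -/
theorem defect_eq_zero (hF : S.IsC2On Ω) (hD : S.IsDarbouxOn Ω)
    {U : (Fin n → ℝ) → S.Unknowns} {xbar : Fin n → ℝ} {R r C : ℝ}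
    (hU : ∀ x ∈ Metric.ball xbar R, ContDiffAt ℝ 2 U x)
    (hΩ : ∀ x ∈ Metric.ball xbar R, (x, U x) ∈ Ω)
    (hE : ∀ x ∈ Metric.ball xbar R, ∀ I : S.idx, fderiv ℝ U x (coordProj I.1 (x - xbar)) I =
      ∑ i, (coordProj I.1 (x - xbar) i) • S.rhsExt I i (x, U x))
    (hC : ∀ x ∈ Metric.ball xbar R, ∀ I i, ‖fderiv ℝ (S.rhsExt I i) (x, U x)‖ ≤ C)
    (hr0 : 0 ≤ r) (hrR : r < R) (hr : n * (r * (2 * C)) ≤ 1 / 2) :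
    ∀ x ∈ Metric.closedBall xbar r, ∀ i, defect U i x = 0 := by
  have hsub : Metric.closedBall xbar r ⊆ Metric.ball xbar R := Metric.closedBall_subset_ball hrR
  have hdiff : ∀ x ∈ Metric.closedBall xbar r, ∀ I i,
      DifferentiableAt ℝ (fun y => defect U i y I) x := fun x hx I i =>
    differentiableAt_defect hF (hU x (hsub hx)) (hΩ x (hsub hx)) I i
  have hcont : ContinuousOn (fun x => ‖fun i => defect U i x‖) (Metric.closedBall xbar r) := by
    refine ContinuousOn.norm (continuousOn_pi.2 fun i => continuousOn_pi.2 fun I => ?_)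
    exact fun x hx => (hdiff x hx I i).continuousAt.continuousWithinAt
  obtain ⟨x₀, hx₀, hmax⟩ := (isCompact_closedBall xbar r).exists_isMaxOn
    (Metric.nonempty_closedBall.2 hr0) hcont
  set M := ‖fun i => defect U i x₀‖ with hM
  have hM0 : 0 ≤ M := norm_nonneg _
  have hdef : ∀ x ∈ Metric.closedBall xbar r, ∀ i, ‖defect U i x‖ ≤ M := fun x hx i =>
    (norm_le_pi_norm (fun i => defect U i x) i).trans (hmax hx)
  have hhalf : ∀ x ∈ Metric.closedBall xbar r, ∀ i I, ‖defect U i x I‖ ≤ 1 / 2 * M := by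
    intro x hx i I
    by_cases hi : i ∈ I.1
    swap
    · simp only [defect, hi, if_false, norm_zero]; positivity
    refine norm_le_of_norm_add_radial_fderiv_le I.1 (δ := fun y => defect U i y I)
      (fun y hy => hdiff y hy I i) (fun y hy => ?_) hx
    have hyB := hsub hy
    have hC0 : 0 ≤ C := (norm_nonneg _).trans (hC y hyB I i)
    rw [defect_add_fderiv_defect hF hD (hU y hyB) (hΩ y hyB)
      (Filter.eventually_of_mem (Metric.isOpen_ball.mem_nhds hyB) fun y hy => hE y hy I) hi]
    have hterm : ∀ k l, ‖fderiv ℝ (S.rhsExt I k) (y, U y) (0, defect U l y)‖ ≤ C * M := by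
      intro k l
      refine (ContinuousLinearMap.le_opNorm _ _).trans
        (mul_le_mul (hC y hyB I k) ?_ (norm_nonneg _) hC0)
      rw [Prod.norm_mk, norm_zero, max_eq_right (norm_nonneg _)]
      exact hdef y hy l
    have hz : ∀ j, ‖coordProj I.1 (y - xbar) j‖ ≤ r := by
      intro j
      rw [coordProj_apply]
      split_ifs
      · exact (norm_le_pi_norm (y - xbar) j).trans (mem_closedBall_iff_norm.1 hy)
      · simpa using hr0
    have hj : ∀ j ∈ (Finset.univ : Finset (Fin n)), ‖coordProj I.1 (y - xbar) j •
        (fderiv ℝ (S.rhsExt I j) (y, U y) (0, defect U i y) -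
          fderiv ℝ (S.rhsExt I i) (y, U y) (0, defect U j y))‖ ≤ r * (C * M + C * M) := by
      intro j _
      rw [norm_smul]
      exact mul_le_mul (hz j) ((norm_sub_le _ _).trans (add_le_add (hterm _ _) (hterm _ _)))
        (norm_nonneg _) hr0
    refine (norm_sum_le_of_le _ hj).trans ?_
    rw [Finset.sum_const, Finset.card_univ, Fintype.card_fin, nsmul_eq_mul]
    calc (n : ℝ) * (r * (C * M + C * M)) = n * (r * (2 * C)) * M := by ring
      _ ≤ 1 / 2 * M := mul_le_mul_of_nonneg_right hr hM0
  have hMle : M ≤ 1 / 2 * M := by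
    have h0 : (0 : ℝ) ≤ 1 / 2 * M := by positivity
    exact (pi_norm_le_iff_of_nonneg h0).2 fun i => (pi_norm_le_iff_of_nonneg h0).2 fun I =>
      hhalf x₀ hx₀ i I
  have hMz : M = 0 := by linarith
  exact fun x hx i => norm_le_zero_iff.1 (hMz ▸ hdef x hx i)

end MultiIndexSystem

/-! ### Uniqueness, and the choice of the radius -/

namespace MultiIndexSystem

variable {n : ℕ} {S : MultiIndexSystem n} {Ω : Set ((Fin n → ℝ) × S.Unknowns)}
  {xbar : Fin n → ℝ} {ubar : S.Data}

/-- Local Lipschitz bounds on a compact set yield a global one there, with no convexity. This allows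
`T` to be the union of two graphs. -/
theorem IsC2On.exists_lipschitz_rhsExt (hF : S.IsC2On Ω) {T : Set ((Fin n → ℝ) × S.Unknowns)}
    (hT : IsCompact T) (hTΩ : T ⊆ Ω) :
    ∃ L : ℝ, 0 < L ∧ ∀ p ∈ T, ∀ q ∈ T, ∀ I i,
      ‖S.rhsExt I i p - S.rhsExt I i q‖ ≤ L * ‖p - q‖ := by
  let H : (Fin n → ℝ) × S.Unknowns → ∀ I : S.idx, Fin n → Fin (S.dim I) → ℝ :=
    fun p I i => S.rhsExt I i p
  have hloc : LocallyLipschitzOn T H := by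
    intro p hp
    have hH : ContDiffAt ℝ 1 H p := contDiffAt_pi.2 fun I => contDiffAt_pi.2 fun i =>
      (hF.contDiffAt_rhsExt (hTΩ hp) I i).of_le (by norm_num)
    obtain ⟨K, t, ht, hK⟩ := hH.exists_lipschitzOnWith
    exact ⟨K, t, mem_nhdsWithin_of_mem_nhds ht, hK⟩
  obtain ⟨K, hK⟩ := hloc.exists_lipschitzOnWith_of_compact hT
  refine ⟨K + 1, by positivity, fun p hp q hq I i => ?_⟩
  have h1 := hK.dist_le_mul p hp q hq
  rw [dist_eq_norm, dist_eq_norm] at h1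
  have h2 : ‖S.rhsExt I i p - S.rhsExt I i q‖ ≤ ‖H p - H q‖ :=
    (norm_le_pi_norm ((H p - H q) I) i).trans (norm_le_pi_norm (H p - H q) I)
  have h3 := norm_nonneg (p - q)
  nlinarith

theorem IsSolution.fderiv_coordProj {V : Set (Fin n → ℝ)} {U : (Fin n → ℝ) → S.Unknowns}
    (h : S.IsSolution Ω xbar ubar V U) {x : Fin n → ℝ} (hx : x ∈ V) (I : S.idx) (z : Fin n → ℝ) :
    fderiv ℝ (fun y => U y I) x (coordProj I.1 z) =
      ∑ i, (coordProj I.1 z i) • S.rhsExt I i (x, U x) := by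
  conv_lhs => rw [pi_eq_sum_univ' (coordProj I.1 z), map_sum]
  refine Finset.sum_congr rfl fun i _ => ?_
  rw [map_smul]
  by_cases hi : i ∈ I.1
  · rw [S.rhsExt_of_mem hi, ← h.eqn x hx I i hi]
  · simp [coordProj_apply, hi]

theorem IsSolution.eqOn_ball (hF : S.IsC2On Ω) {r : ℝ} {U U' : (Fin n → ℝ) → S.Unknowns}
    (h : S.IsSolution Ω xbar ubar (Metric.ball xbar r) U)
    (h' : S.IsSolution Ω xbar ubar (Metric.ball xbar r) U') :
    Set.EqOn U' U (Metric.ball xbar r) := by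
  intro x hx
  set K := Metric.closedBall xbar ‖x - xbar‖ with hK
  have hKV : K ⊆ Metric.ball xbar r := Metric.closedBall_subset_ball (mem_ball_iff_norm.1 hx)
  have hKc : IsCompact K := isCompact_closedBall _ _
  have hxK : x ∈ K := mem_closedBall_iff_norm.2 le_rfl
  have hUc : ContinuousOn U K := h.contDiffOn.continuousOn.mono hKV
  have hUc' : ContinuousOn U' K := h'.contDiffOn.continuousOn.mono hKV
  obtain ⟨L, hL, hLip⟩ := hF.exists_lipschitz_rhsExt
    (T := (fun y => (y, U' y)) '' K ∪ (fun y => (y, U y)) '' K)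
    ((hKc.image_of_continuousOn (continuousOn_id.prodMk hUc')).union
      (hKc.image_of_continuousOn (continuousOn_id.prodMk hUc)))
    (Set.union_subset (Set.image_subset_iff.2 fun y hy => h'.mem_domain y (hKV hy))
      (Set.image_subset_iff.2 fun y hy => h.mem_domain y (hKV hy)))
  have hLip' : ∀ y ∈ K, ∀ I i,
      ‖S.rhsExt I i (y, U' y) - S.rhsExt I i (y, U y)‖ ≤ L * ‖U' y - U y‖ := by
    intro y hy I i
    refine (hLip _ (Or.inl ⟨y, hy, rfl⟩) _ (Or.inr ⟨y, hy, rfl⟩) I i).trans_eq ?_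
    rw [Prod.mk_sub_mk, sub_self, Prod.norm_mk, norm_zero, max_eq_right (norm_nonneg _)]
  let N : (Fin n → ℝ) → ℝ := fun y => ∑ i, |y i - xbar i|
  -- The weight `exp(-2 L N)` replaces smallness of the ball: `N` grows at rate `a = ∑ |z i|` along
  -- each segment, so integrating a bound `a L M exp(2 L N)` gains a factor `1/2`.
  obtain ⟨y₀, hy₀, hmax⟩ := hKc.exists_isMaxOn ⟨x, hxK⟩
    (f := fun y => Real.exp (-(2 * L * N y)) * ‖U' y - U y‖)
    (ContinuousOn.mul (Continuous.continuousOn (by fun_prop)) (hUc'.sub hUc).norm)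
  set M := Real.exp (-(2 * L * N y₀)) * ‖U' y₀ - U y₀‖ with hM
  have hM0 : 0 ≤ M := by positivity
  have hbound : ∀ y ∈ K, ‖U' y - U y‖ ≤ M * Real.exp (2 * L * N y) := by
    intro y hy
    have h1 : Real.exp (-(2 * L * N y)) * ‖U' y - U y‖ ≤ M := hmax hy
    rw [Real.exp_neg, inv_mul_le_iff₀ (Real.exp_pos _)] at h1
    rwa [mul_comm]
  have hdiff : ∀ {W : (Fin n → ℝ) → S.Unknowns},
      S.IsSolution Ω xbar ubar (Metric.ball xbar r) W → ∀ y ∈ K, ∀ I,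
        DifferentiableAt ℝ (fun y => W y I) y := fun hW y hy I =>
    differentiableAt_pi.1 ((hW.contDiffOn.contDiffAt
      (Metric.isOpen_ball.mem_nhds (hKV hy))).differentiableAt two_ne_zero) I
  have hhalf : ∀ y ∈ K, ‖U' y - U y‖ ≤ M / 2 * Real.exp (2 * L * N y) := by
    intro y hy
    refine (pi_norm_le_iff_of_nonneg (by positivity)).2 fun I => ?_
    set z := coordProj I.1 (y - xbar) with hz
    set a := ∑ i, |z i| with ha
    let c : ℝ → Fin n → ℝ := fun s => y + (s - 1) • z
    have hcK : ∀ s ∈ Set.Icc (0 : ℝ) 1, c s ∈ K := fun s hs =>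
      add_smul_coordProj_mem_closedBall I.1 hy hs
    have hN : ∀ s ∈ Set.Icc (0 : ℝ) 1, N (c s) = N y + (s - 1) * a := by
      intro s hs
      simp only [N, ha, Finset.mul_sum, ← Finset.sum_add_distrib]
      refine Finset.sum_congr rfl fun i _ => ?_
      simp only [c, hz, Pi.add_apply, Pi.smul_apply, Pi.sub_apply, coordProj_apply, smul_eq_mul]
      split_ifs
      · rw [show y i + (s - 1) * (y i - xbar i) - xbar i = s * (y i - xbar i) by ring, abs_mul,
          abs_of_nonneg hs.1]
        ring
      · simp
    have hderiv : ∀ {W : (Fin n → ℝ) → S.Unknowns},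
        S.IsSolution Ω xbar ubar (Metric.ball xbar r) W → ∀ s ∈ Set.Icc (0 : ℝ) 1,
          HasDerivAt (fun s => W (c s) I) (∑ i, z i • S.rhsExt I i (c s, W (c s))) s := by
      intro W hW s hs
      have h1 := (hdiff hW _ (hcK s hs) I).hasFDerivAt.comp_hasDerivAt s (hasDerivAt_add_smul y z s)
      rw [hz, hW.fderiv_coordProj (hKV (hcK s hs)) I] at h1
      exact h1
    have hg : ∀ s ∈ Set.Icc (0 : ℝ) 1, HasDerivAt (fun s => U' (c s) I - U (c s) I)
        (∑ i, z i • S.rhsExt I i (c s, U' (c s)) - ∑ i, z i • S.rhsExt I i (c s, U (c s))) s :=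
      fun s hs => (hderiv h' s hs).sub (hderiv h s hs)
    have hB : ∀ s : ℝ, HasDerivAt (fun s => M / 2 * Real.exp (2 * L * (N y + (s - 1) * a)))
        (a * (L * (M * Real.exp (2 * L * (N y + (s - 1) * a))))) s := by
      intro s
      have h1 : HasDerivAt (fun s : ℝ => 2 * L * (N y + (s - 1) * a)) (2 * L * (1 * a)) s :=
        ((((hasDerivAt_id s).sub_const 1).mul_const a).const_add (N y)).const_mul (2 * L)
      convert! h1.exp.const_mul (M / 2) using 1
      ring
    -- At `s = 0` both solutions take the same data, so the difference starts at `0` below the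
    -- positive barrier of `hB`.
    have hfence := image_norm_le_of_norm_deriv_right_le_deriv_boundary (a := 0) (b := 1)
      (f := fun s => U' (c s) I - U (c s) I)
      (fun s hs => (hg s hs).continuousAt.continuousWithinAt)
      (fun s hs => (hg s (Set.Ico_subset_Icc_self hs)).hasDerivWithinAt) ?_ hB ?_
      (Set.right_mem_Icc.2 zero_le_one)
    · simpa [c] using hfence
    · have h0 : (0 : ℝ) ∈ Set.Icc (0 : ℝ) 1 := Set.left_mem_Icc.2 zero_le_one
      have hc0 : ∀ i ∈ I.1, c 0 i = xbar i := fun i hi => by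
        simp [c, hz, coordProj_apply, hi]
      rw [h'.data _ (hKV (hcK 0 h0)) I hc0, h.data _ (hKV (hcK 0 h0)) I hc0, sub_self, norm_zero]
      positivity
    · intro s hs
      have hs' := Set.Ico_subset_Icc_self hs
      rw [← Finset.sum_sub_distrib, ← hN s hs', ha, Finset.sum_mul]
      refine norm_sum_le_of_le _ fun i _ => ?_
      rw [← smul_sub, norm_smul, Real.norm_eq_abs]
      exact mul_le_mul_of_nonneg_left ((hLip' _ (hcK s hs') I i).trans
        (mul_le_mul_of_nonneg_left (hbound _ (hcK s hs')) hL.le)) (abs_nonneg _)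
  have hMle : M ≤ M / 2 := by
    refine hM.le.trans ?_
    rw [Real.exp_neg, inv_mul_le_iff₀ (Real.exp_pos _), mul_comm]
    exact hhalf y₀ hy₀
  have hMz : M = 0 := by linarith
  have h1 := hbound x hxK
  rw [hMz, zero_mul] at h1
  exact sub_eq_zero.1 (norm_le_zero_iff.1 h1)

theorem exists_isSolution_ball (hΩ : IsOpen Ω) {Ubar : S.Unknowns} (hmem : (xbar, Ubar) ∈ Ω)
    (hF : S.IsC2On Ω) (hD : S.IsDarbouxOn Ω)
    (hu : ∀ I, ContDiffAt ℝ 2 (ubar I) (S.compl I xbar))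
    (hbar : ∀ I, ubar I (S.compl I xbar) = Ubar I) :
    ∃ r₀ > 0, ∃ U, ∀ r, 0 < r → r < r₀ → S.IsSolution Ω xbar ubar (Metric.ball xbar r) U := by
  obtain ⟨U, hU, hU0, hrad⟩ := hF.exists_radial_solution hmem hu hbar
  have hgraph : ContinuousAt (fun x => (x, U x)) xbar := continuousAt_id.prodMk hU.continuousAt
  have hp : (xbar, U xbar) ∈ Ω := by rwa [hU0]
  let A : (Fin n → ℝ) → ∀ I : S.idx, Fin n →
      ((Fin n → ℝ) × S.Unknowns →L[ℝ] (Fin (S.dim I) → ℝ)) :=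
    fun x I i => fderiv ℝ (S.rhsExt I i) (x, U x)
  have hA : ContinuousAt A xbar := continuousAt_pi.2 fun I => continuousAt_pi.2 fun i =>
    ContinuousAt.comp (f := fun x => (x, U x))
      (((hF.contDiffAt_rhsExt hp I i).fderiv_right (m := 0) (by norm_num)).continuousAt) hgraph
  set C := ‖A xbar‖ + 1 with hC
  obtain ⟨R, hR, hball⟩ := Metric.eventually_nhds_iff_ball.1
    (((hU.eventually (by simp)).and (hgraph.eventually (hΩ.mem_nhds hp))).and
      (hrad.and (hA.norm.eventually (gt_mem_nhds (lt_add_one ‖A xbar‖)))))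
  -- The second bound gives `n * (r * (2 * C)) ≤ 1 / 2`; `n + 1` keeps the denominator positive when
  -- `n = 0`.
  refine ⟨min R (1 / (4 * (n + 1) * C)), by positivity, U, fun r hr0 hr => ?_⟩
  have hrR : r < R := hr.trans_le (min_le_left _ _)
  have hrC : n * (r * (2 * C)) ≤ 1 / 2 := by
    have h1 := hr.trans_le (min_le_right _ _)
    rw [lt_div_iff₀ (by positivity)] at h1
    have h2 : 0 < r * C := by positivity
    nlinarith
  have hdiff : ∀ x ∈ Metric.ball xbar R, ∀ I z,
      fderiv ℝ (fun y => U y I) x z = fderiv ℝ U x z I := fun x hx I z => by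
    rw [fderiv_pi (fun I => differentiableAt_pi.1
      ((hball x hx).1.1.differentiableAt two_ne_zero) I)]
    rfl
  have hdef := defect_eq_zero hF hD (fun x hx => (hball x hx).1.1) (fun x hx => (hball x hx).1.2)
    (fun x hx I => by rw [← hdiff x hx]; exact ((hball x hx).2.1 I).2)
    (fun x hx I i => ((norm_le_pi_norm (A x I) i).trans (norm_le_pi_norm (A x) I)).trans
      (hball x hx).2.2.le) hr0.le hrR hrC
  have hsub : Metric.ball xbar r ⊆ Metric.ball xbar R := Metric.ball_subset_ball hrR.le
  refine ⟨fun x hx => (hball x (hsub hx)).1.1.contDiffWithinAt,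
    fun x hx => (hball x (hsub hx)).1.2, fun x hx I i hi => ?_,
    fun x hx I => ((hball x (hsub hx)).2.1 I).1⟩
  have h1 := congrFun (hdef x (Metric.ball_subset_closedBall hx) i) I
  simp only [defect, hi, if_true, Pi.zero_apply] at h1
  rw [hdiff x (hsub hx), sub_eq_zero.1 h1, S.rhsExt_of_mem hi]

end MultiIndexSystem

theorem mainTheorem2 {n : ℕ} (S : MultiIndexSystem n)
    (xbar : Fin n → ℝ) (Ubar : S.Unknowns)
    (Ω : Set ((Fin n → ℝ) × S.Unknowns)) (hΩ : IsOpen Ω) (hmem : (xbar, Ubar) ∈ Ω)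
    (hF : S.IsC2On Ω) (hD : S.IsDarbouxOn Ω)
    (ubar : S.Data) (hu : ∀ I, ContDiffAt ℝ 2 (ubar I) (S.compl I xbar))
    (hbar : ∀ I, ubar I (S.compl I xbar) = Ubar I) :
    ∀ W ∈ 𝓝 xbar, ∃ V ⊆ W, IsOpen V ∧ xbar ∈ V ∧
      ∃ U, S.IsSolution Ω xbar ubar V U ∧
        ∀ U', S.IsSolution Ω xbar ubar V U' → Set.EqOn U' U V := by
  intro W hW
  obtain ⟨ε, hε, hεW⟩ := Metric.mem_nhds_iff.1 hW
  obtain ⟨r₀, hr₀, U, hU⟩ := MultiIndexSystem.exists_isSolution_ball hΩ hmem hF hD hu hbar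
  obtain ⟨r, hr0, hr⟩ := exists_between (lt_min hε hr₀)
  have hsol := hU r hr0 (hr.trans_le (min_le_right _ _))
  exact ⟨Metric.ball xbar r,
    (Metric.ball_subset_ball (hr.le.trans (min_le_left _ _))).trans hεW, Metric.isOpen_ball,
    Metric.mem_ball_self hr0, U, hsol, fun U' hU' => hsol.eqOn_ball hF hU'⟩
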